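/- Let $\alpha,\beta>-1$ be real, let $n\ge 0$ be an integer, and for real $a,b$ let $P_m^{(a,b)}$ denote the Jacobi polynomial $$P_m^{(a,b)}(x)=\sum_{k=0}^{m}\frac{(m+a+b+1)_k\,(a+k+1)_{m-k}}{k!\,(m-k)!}\Big(\frac{x-1}{2}\Big)^k,\qquad (c)_k=c(c+1)\cdots(c+k-1).$$ Let $x_0<x_1<\dots<x_n$ be the roots of $P_{n+1}^{(\alpha,\beta+1)}$. Then there is exactly one choice of real weights $\hat w_1,\tilde w_0,\dots,\tilde w_n$ (the weights of the Gauss–Jacobi–Radau quadrature rule) such that $$\int_{-1}^1(1-x)^\alpha(1+x)^\beta f(x)\,dx=\hat w_1 f(-1)+\sum_{j=0}^n\tilde w_j f(x_j)$$ for every real polynomial $f$ of degree at most $2n+2$. For real $a,b>-1$ put $$C_n^{(a,b)}=(-1)^n\,\frac{\Gamma(2n+a+b+3)}{2^{\,n+1+\frac{a+b+1}{2}}}\,\frac{1}{\sqrt{(n+1)!\,\Gamma(n+a+b+2)\,\Gamma(n+a+2)\,\Gamma(n+b+2)}} .$$ The barycentric weights of the $n+2$ interpolation points $-1,x_0,\dots,x_n$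 (the barycentric weight of a point $y$ in a finite point set $Y$ is $\prod_{z\in Y,\,z\ne y}(y-z)^{-1}$), denoted $\tilde\lambda_j$ at $x_j$ and $\hat\lambda_1$ at $-1$, are $$\tilde\lambda_j=C_n^{(\alpha,\beta+1)}(-1)^j\sqrt{(1-x_j)\tilde w_j}\quad(j=0,\dots,n),\qquad \hat\lambda_1=-C_n^{(\alpha,\beta+1)}\sqrt{2(\beta+1)\hat w_1}.$$ Moreover, the numbers $(-1)^j\sqrt{(1-x_j)\tilde w_j}$ $(j=0,\dots,n)$ at the $x_j$ and $-\sqrt{2(\beta+1)\hat w_1}$ at $-1$ are simplified barycentric weights, i.e. they are obtained from the barycentric weights by cancelling a common nonzero factor. -/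

import Mathlib

open Polynomial

noncomputable section

/-- The Jacobi polynomial `P_n^{(a,b)}` in its standard normalization, as a real polynomial:
`P_n^{(a,b)}(x) = ∑_{k=0}^{n} (n+a+b+1)_k (a+k+1)_{n-k} / (k! (n-k)!) * ((x-1)/2)^k`,
where `(c)_k = c (c+1) ⋯ (c+k-1)`. -/
def jacobiPoly (n : ℕ) (a b : ℝ) : ℝ[X] :=
  ∑ k ∈ Finset.range (n + 1),
    C ((ascPochhammer ℝ k).eval ((n : ℝ) + a + b + 1) *
        (ascPochhammer ℝ (n - k)).eval (a + (k : ℝ) + 1) /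
          ((k.factorial : ℝ) * ((n - k).factorial : ℝ))) *
      (C (1 / 2 : ℝ) * (X - 1)) ^ k

/-- The Jacobi weight function `(1-x)^a (1+x)^b`. -/
def jacobiWeight (a b x : ℝ) : ℝ := (1 - x) ^ a * (1 + x) ^ b

/-- The nodes `-1, x_0, …, x_n`: index `0` is the added endpoint `-1`, and index `j + 1` is the
interior node `x_j`. -/
def radauNodes {n : ℕ} (x : Fin (n + 1) → ℝ) : Fin (n + 2) → ℝ := Fin.cons (-1) x

/-- `w` is the vector of weights of the Gauss-Jacobi-Radau quadrature rule for the weight function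
`(1-x)^α (1+x)^β` with preassigned node `-1` and further nodes `x_0, …, x_n`: the rule
`w 0 * f (-1) + ∑ j, w (j + 1) * f (x_j)` is exact on all polynomials of degree at most
`2 n + 2`. -/
def IsGaussJacobiRadauWeights (α β : ℝ) {n : ℕ} (x : Fin (n + 1) → ℝ)
    (w : Fin (n + 2) → ℝ) : Prop :=
  ∀ f : ℝ[X], f.natDegree ≤ 2 * n + 2 →
    ∫ t in (-1 : ℝ)..1, jacobiWeight α β t * f.eval t =
      ∑ i, w i * f.eval (radauNodes x i)

/-- The barycentric weights `∏_{k ≠ i} (y_i - y_k)⁻¹` of the nodes `y_0, …, y_m`. -/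
def baryWeight {m : ℕ} (y : Fin (m + 1) → ℝ) (i : Fin (m + 1)) : ℝ :=
  Lagrange.nodalWeight Finset.univ y i

/-- `μ` is a vector of simplified barycentric weights: it arises from the barycentric weights by
cancelling a common nonzero factor. -/
def IsSimplifiedBaryWeights {m : ℕ} (y : Fin (m + 1) → ℝ) (μ : Fin (m + 1) → ℝ) : Prop :=
  ∃ c : ℝ, c ≠ 0 ∧ ∀ i, baryWeight y i = c * μ i

/-- The constant `C_n^{(a,b)}`, with sign `+1` for even `n` and `-1` for odd `n`. -/
def jacobiBaryConst (n : ℕ) (a b : ℝ) : ℝ :=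
  (-1) ^ n * (Real.Gamma (2 * n + a + b + 3) / (2 : ℝ) ^ ((n : ℝ) + 1 + (a + b + 1) / 2)) *
    (1 / √(((n + 1).factorial : ℝ) * Real.Gamma (n + a + b + 2) * Real.Gamma (n + a + 2) *
      Real.Gamma (n + b + 2)))

end

/-! Let `p = ∏ (X - x_j)`, the monic multiple of the Jacobi polynomial for the exponents `(α, β+1)`.
All nodes together have nodal polynomial `(1+X) p`, so the barycentric weights are `1 / ((1+x_j)
p'(x_j))` and `1 / p(-1)`. The claim is that `(1-x_j) w_{j+1}` and `2(β+1) w_0` are the squares of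
these numbers times one common constant `K`.

For the interior nodes, testing the Radau rule on multiples of `1+X` turns it into the Gauss rule
for `(α, β+1)`, so `(1+x_j) w_{j+1}` is a Gauss weight, and `gaussJacobiWeight_mul` gives `K =
(2(n+1)+α+(β+1)+1) h`, with `h` the squared norm of `p` for `(α, β+1)`. For the endpoint, testing on
`p²` gives `w_0 p(-1)² = ∫ p²` against the weight `(α, β)`, and `jacobiFunctional_nodal_sq` shows
that this integral times `2(β+1)` is the same `K`. Both identities come from integration by parts
and orthogonality.

The explicit value of `h` gives `C² K = 1` (`jacobiBaryConstAbs_sq_mul`), and the ordering of the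
roots fixes the signs of the square roots. -/

open Polynomial

/-! ### Integration against the Jacobi weight -/

noncomputable section

open intervalIntegral MeasureTheory in
theorem intervalIntegrable_jacobiWeight {a b : ℝ} (ha : -1 < a) (hb : -1 < b) :
    IntervalIntegrable (jacobiWeight a b) volume (-1) 1 := by
  -- On `[-1, 0]` only `(1+t)^b` can be singular, so the other exponent is arbitrary. The reflection
  -- `t ↦ -t` swaps the exponents and gives the other half.
  have left : ∀ {a b : ℝ}, -1 < b →
      IntervalIntegrable (fun t : ℝ => (1 - t) ^ a * (1 + t) ^ b) volume (-1) 0 := by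
    intro a b hb
    apply IntervalIntegrable.continuousOn_mul
    · have := (intervalIntegrable_rpow' (a := 0) (b := 1) hb).comp_add_left 1
      simpa using this
    · rw [Set.uIcc_of_le (by norm_num)]
      apply ContinuousOn.rpow_const (by fun_prop)
      intro t ht
      left
      linarith [ht.2]
  refine (left hb).trans ?_
  rw [IntervalIntegrable.iff_comp_neg]
  simpa [mul_comm, ← sub_eq_add_neg] using (left (a := b) ha).symm

theorem intervalIntegrable_jacobiWeight_mul {a b : ℝ} (ha : -1 < a) (hb : -1 < b) (f : ℝ[X]) :
    IntervalIntegrable (fun t => jacobiWeight a b t * f.eval t) MeasureTheory.volume (-1) 1 :=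
  (intervalIntegrable_jacobiWeight ha hb).mul_continuousOn f.continuous.continuousOn

/-- Integration of polynomials against the Jacobi weight, as a linear functional. -/
def jacobiFunctional {a b : ℝ} (ha : -1 < a) (hb : -1 < b) : ℝ[X] →ₗ[ℝ] ℝ where
  toFun f := ∫ t in (-1 : ℝ)..1, jacobiWeight a b t * f.eval t
  map_add' f g := by
    rw [← intervalIntegral.integral_add (intervalIntegrable_jacobiWeight_mul ha hb f)
      (intervalIntegrable_jacobiWeight_mul ha hb g)]
    simp only [eval_add, mul_add]
  map_smul' c f := by
    rw [RingHom.id_apply, smul_eq_mul, ← intervalIntegral.integral_const_mul]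
    simp only [eval_smul, smul_eq_mul, mul_left_comm]

theorem jacobiFunctional_apply {a b : ℝ} (ha : -1 < a) (hb : -1 < b) (f : ℝ[X]) :
    jacobiFunctional ha hb f = ∫ t in (-1 : ℝ)..1, jacobiWeight a b t * f.eval t := rfl

theorem jacobiFunctional_C_mul {a b : ℝ} (ha : -1 < a) (hb : -1 < b) (c : ℝ) (f : ℝ[X]) :
    jacobiFunctional ha hb (C c * f) = c * jacobiFunctional ha hb f := by
  rw [← smul_eq_C_mul, map_smul, smul_eq_mul]

theorem jacobiFunctional_nonneg {a b : ℝ} (ha : -1 < a) (hb : -1 < b) {f : ℝ[X]}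
    (hf : ∀ t, 0 ≤ f.eval t) : 0 ≤ jacobiFunctional ha hb f := by
  rw [jacobiFunctional_apply]
  apply intervalIntegral.integral_nonneg (by norm_num)
  intro t ht
  have h1 : 0 ≤ 1 - t := by linarith [ht.2]
  have h2 : 0 ≤ 1 + t := by linarith [ht.1]
  exact mul_nonneg (mul_nonneg (Real.rpow_nonneg h1 _) (Real.rpow_nonneg h2 _)) (hf t)

open Set in
/-- Two Jacobi functionals agree once the integrands agree on the open interval. -/
theorem jacobiFunctional_congr {a b a' b' : ℝ} (ha : -1 < a) (hb : -1 < b) (ha' : -1 < a')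
    (hb' : -1 < b') {f g : ℝ[X]}
    (h : ∀ t ∈ Ioo (-1 : ℝ) 1, jacobiWeight a b t * f.eval t = jacobiWeight a' b' t * g.eval t) :
    jacobiFunctional ha hb f = jacobiFunctional ha' hb' g := by
  rw [jacobiFunctional_apply, jacobiFunctional_apply,
    intervalIntegral.integral_of_le (by norm_num), intervalIntegral.integral_of_le (by norm_num),
    MeasureTheory.integral_Ioc_eq_integral_Ioo, MeasureTheory.integral_Ioc_eq_integral_Ioo]
  exact MeasureTheory.setIntegral_congr_fun measurableSet_Ioo h

/-- This passage between the exponents `b` and `b + 1` links the Radau rule to the Gauss rule. -/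
theorem jacobiFunctional_one_add_X_mul {a b : ℝ} (ha : -1 < a) (hb : -1 < b) (hb' : -1 < b + 1)
    (f : ℝ[X]) :
    jacobiFunctional ha hb ((1 + X) * f) = jacobiFunctional ha hb' f := by
  apply jacobiFunctional_congr
  intro t ht
  have h2 : 0 < 1 + t := by linarith [ht.1]
  rw [jacobiWeight, jacobiWeight, Real.rpow_add h2, Real.rpow_one]
  simp only [eval_mul, eval_add, eval_one, eval_X]
  ring

/-- The integrand is the derivative of `(1-t)^(a+1) (1+t)^(b+1) q(t)`, which vanishes at both
endpoints because the exponents are positive. -/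
theorem jacobiFunctional_integrate_by_parts {a b : ℝ} (ha : -1 < a) (hb : -1 < b) (q : ℝ[X]) :
    jacobiFunctional ha hb ((1 - X ^ 2) * derivative q + C (b + 1) * ((1 - X) * q)
      - C (a + 1) * ((1 + X) * q)) = 0 := by
  rw [jacobiFunctional_apply, intervalIntegral.integral_eq_sub_of_hasDerivAt_of_le (by norm_num)
    (f := fun t => (1 - t) ^ (a + 1) * (1 + t) ^ (b + 1) * q.eval t)]
  · have h1 : a + 1 ≠ 0 := by linarith
    have h2 : b + 1 ≠ 0 := by linarith
    simp [Real.zero_rpow h1, Real.zero_rpow h2]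
  · apply ContinuousOn.mul (ContinuousOn.mul _ _) q.continuous.continuousOn
    · exact ContinuousOn.rpow_const (by fun_prop) fun _ _ => Or.inr (by linarith)
    · exact ContinuousOn.rpow_const (by fun_prop) fun _ _ => Or.inr (by linarith)
  · intro t ht
    have h1 : 0 < 1 - t := by linarith [ht.2]
    have h2 : 0 < 1 + t := by linarith [ht.1]
    have d1 : HasDerivAt (fun t : ℝ => 1 - t) (-1) t := by
      simpa using (hasDerivAt_id t).const_sub 1
    have d2 : HasDerivAt (fun t : ℝ => 1 + t) 1 t := by
      simpa using (hasDerivAt_id t).const_add 1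
    refine (((d1.rpow_const (p := a + 1) (Or.inl h1.ne')).mul
      (d2.rpow_const (p := b + 1) (Or.inl h2.ne'))).mul (q.hasDerivAt t)).congr_deriv ?_
    simp only [Pi.mul_apply, add_sub_cancel_right, jacobiWeight, Real.rpow_add h1, Real.rpow_add h2,
      Real.rpow_one, eval_add, eval_sub, eval_mul, eval_one, eval_X, eval_C, eval_pow]
    ring
  · exact intervalIntegrable_jacobiWeight_mul ha hb _

theorem integral_jacobiWeight {a b : ℝ} (ha : -1 < a) (hb : -1 < b) :
    ∫ t in (-1 : ℝ)..1, jacobiWeight a b t =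
      2 ^ (a + b + 1) * (Real.Gamma (a + 1) * Real.Gamma (b + 1) / Real.Gamma (a + b + 2)) := by
  have key : ∫ t in (0 : ℝ)..1, t ^ b * (1 - t) ^ a
      = Real.Gamma (b + 1) * Real.Gamma (a + 1) / Real.Gamma (b + 1 + (a + 1)) := by
    have h := ProbabilityTheory.beta_eq_betaIntegralReal (b + 1) (a + 1) (by linarith)
      (by linarith)
    rw [ProbabilityTheory.beta] at h
    rw [h, ← Complex.ofReal_re (∫ t in (0 : ℝ)..1, t ^ b * (1 - t) ^ a),
      ← intervalIntegral.integral_ofReal, Complex.betaIntegral]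
    congr 1
    apply intervalIntegral.integral_congr
    intro t ht
    rw [Set.uIcc_of_le (by norm_num)] at ht
    have h1 : 0 ≤ 1 - t := by linarith [ht.2]
    simp only [Complex.ofReal_mul, Complex.ofReal_cpow ht.1, Complex.ofReal_cpow h1]
    push_cast
    simp
  -- The substitution `t ↦ 2t - 1` reduces the integral to the Beta integral on `[0, 1]`.
  have sub : ∫ t in (0 : ℝ)..1, jacobiWeight a b (2 * t - 1)
      = 2⁻¹ * ∫ t in (-1 : ℝ)..1, jacobiWeight a b t := by
    rw [intervalIntegral.integral_comp_mul_sub _ two_ne_zero]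
    norm_num
  have sub' : ∫ t in (0 : ℝ)..1, jacobiWeight a b (2 * t - 1)
      = 2 ^ (a + b) * ∫ t in (0 : ℝ)..1, t ^ b * (1 - t) ^ a := by
    rw [← intervalIntegral.integral_const_mul]
    apply intervalIntegral.integral_congr
    intro t ht
    rw [Set.uIcc_of_le (by norm_num)] at ht
    have h1 : 0 ≤ 1 - t := by linarith [ht.2]
    have e1 : 1 - (2 * t - 1) = 2 * (1 - t) := by ring
    have e2 : 1 + (2 * t - 1) = 2 * t := by ring
    simp only [jacobiWeight]
    rw [e1, e2, Real.mul_rpow (by norm_num) h1, Real.mul_rpow (by norm_num) ht.1,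
      Real.rpow_add (by norm_num)]
    ring
  rw [sub', key] at sub
  have e : b + 1 + (a + 1) = a + b + 2 := by ring
  rw [e] at sub
  rw [Real.rpow_add_one (by norm_num), mul_comm (Real.Gamma (a + 1))]
  linarith

theorem jacobiFunctional_moment {a b : ℝ} (ha : -1 < a) (hb : -1 < b) (k m : ℕ) :
    jacobiFunctional ha hb ((1 - X) ^ k * (1 + X) ^ m) =
      2 ^ (a + b + k + m + 1) * (Real.Gamma (a + k + 1) * Real.Gamma (b + m + 1) /
        Real.Gamma (a + b + k + m + 2)) := by
  have hk : (0 : ℝ) ≤ k := k.cast_nonneg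
  have hm : (0 : ℝ) ≤ m := m.cast_nonneg
  have ha' : -1 < a + k := by linarith
  have hb' : -1 < b + m := by linarith
  rw [jacobiFunctional_congr ha hb ha' hb' (g := 1), jacobiFunctional_apply]
  · simp only [eval_one, mul_one]
    rw [integral_jacobiWeight ha' hb']
    ring_nf
  · intro t ht
    have h1 : 0 < 1 - t := by linarith [ht.2]
    have h2 : 0 < 1 + t := by linarith [ht.1]
    simp only [jacobiWeight, Real.rpow_add h1, Real.rpow_add h2, Real.rpow_natCast, eval_mul,
      eval_pow, eval_add, eval_sub, eval_one, eval_X]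
    ring

end

/-! ### Orthogonality of the Jacobi polynomials -/

noncomputable section

theorem ascPochhammer_eval_mul_Gamma {s : ℝ} (hs : 0 < s) (k : ℕ) :
    (ascPochhammer ℝ k).eval s * Real.Gamma s = Real.Gamma (s + k) := by
  induction k with
  | zero => simp
  | succ k ih =>
    have hk : (0 : ℝ) ≤ k := k.cast_nonneg
    rw [ascPochhammer_succ_eval, mul_right_comm, ih, Nat.cast_succ, ← add_assoc,
      Real.Gamma_add_one (by linarith)]
    ring

/-- The alternating binomial sum of `Γ(s + k) / Γ(t + k)`. -/
theorem sum_neg_one_pow_choose_mul_Gamma_div (N : ℕ) {s t : ℝ} (hs : 0 < s) (ht : 0 < t) :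
    ∑ k ∈ Finset.range (N + 1),
        (-1) ^ k * (N.choose k : ℝ) * (Real.Gamma (s + k) / Real.Gamma (t + k)) =
      (ascPochhammer ℝ N).eval (t - s) * (Real.Gamma s / Real.Gamma (t + N)) := by
  induction N generalizing s t with
  | zero => simp
  | succ N ih =>
    -- Pascal's rule: the sum for `N + 1` is the sum for `N` minus the same sum for the shifted
    -- sequence. The shift replaces `(s, t)` by `(s+1, t+1)` and keeps `t - s`.
    have split : ∀ f : ℕ → ℝ, ∑ k ∈ Finset.range (N + 1 + 1),
        (-1) ^ k * ((N + 1).choose k : ℝ) * f k =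
        ∑ k ∈ Finset.range (N + 1), (-1) ^ k * (N.choose k : ℝ) * f k
        - ∑ k ∈ Finset.range (N + 1), (-1) ^ k * (N.choose k : ℝ) * f (k + 1) := by
      intro f
      rw [Finset.sum_range_succ',
        Finset.sum_range_succ' (fun k => (-1 : ℝ) ^ k * (N.choose k : ℝ) * f k) N]
      have hz : ∑ k ∈ Finset.range (N + 1), (-1 : ℝ) ^ (k + 1) * (N.choose (k + 1) : ℝ) * f (k + 1)
        = ∑ k ∈ Finset.range N, (-1 : ℝ) ^ (k + 1) * (N.choose (k + 1) : ℝ) * f (k + 1) := by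
        rw [Finset.sum_range_succ]
        simp
      rw [← hz]
      simp only [Nat.choose_succ_succ, Nat.cast_add, Nat.choose_zero_right]
      rw [add_sub_right_comm, ← Finset.sum_sub_distrib]
      congr 1
      apply Finset.sum_congr rfl
      intro k _
      ring
    rw [split fun k => Real.Gamma (s + k) / Real.Gamma (t + k), ih hs ht]
    have h2 := ih (s := s + 1) (t := t + 1) (by linarith) (by linarith)
    have e : ∀ (u : ℝ) (k : ℕ), u + ((k + 1 : ℕ) : ℝ) = u + 1 + k := by
      intro u k; push_cast; ring
    simp only [e]
    rw [h2, ascPochhammer_succ_eval, Real.Gamma_add_one hs.ne']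
    have hN : (0 : ℝ) ≤ N := N.cast_nonneg
    have e3 : t + 1 + N = t + N + 1 := by ring
    have e4 : t + 1 - (s + 1) = t - s := by ring
    have hG : Real.Gamma (t + N) ≠ 0 := (Real.Gamma_pos_of_pos (by linarith)).ne'
    have htN : t + N ≠ 0 := by linarith
    rw [e3, e4, Real.Gamma_add_one htN]
    field_simp
    ring

theorem ascPochhammer_eval_neg_of_lt {m N : ℕ} (h : m < N) :
    (ascPochhammer ℝ N).eval ((m : ℝ) + 1 - N) = 0 := by
  have : (m : ℝ) + 1 - N = -((N - 1 - m : ℕ) : ℝ) := by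
    rw [Nat.sub_sub, Nat.cast_sub (by omega)]
    push_cast
    ring
  rw [this, ascPochhammer_eval_neg_coe_nat_of_lt (by omega)]

/-- Integrating term by term gives the alternating sum with `s = N+a+b+1` and `t = a+b+m+2`. Then `t
- s = m+1-N`, so the Pochhammer factor vanishes for `m < N`, which is orthogonality. -/
theorem jacobiFunctional_jacobiPoly_mul {a b : ℝ} (ha : -1 < a) (hb : -1 < b) {N : ℕ}
    (hs : 0 < (N : ℝ) + a + b + 1) (m : ℕ) :
    jacobiFunctional ha hb (jacobiPoly N a b * (1 + X) ^ m) =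
      2 ^ (a + b + m + 1) * Real.Gamma (a + N + 1) * Real.Gamma (b + m + 1) /
        (N.factorial * Real.Gamma (a + b + m + N + 2)) *
          (ascPochhammer ℝ N).eval ((m : ℝ) + 1 - N) := by
  have hm : (0 : ℝ) ≤ m := m.cast_nonneg
  have ht : 0 < a + b + m + 2 := by linarith
  have key := sum_neg_one_pow_choose_mul_Gamma_div N hs ht
  have hGs := (Real.Gamma_pos_of_pos hs).ne'
  have e1 : a + b + m + 2 - (N + a + b + 1) = (m : ℝ) + 1 - N := by ring
  have e2 : a + b + m + 2 + N = a + b + m + N + 2 := by ring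
  rw [e1, e2] at key
  have step : jacobiFunctional ha hb (jacobiPoly N a b * (1 + X) ^ m) =
      2 ^ (a + b + m + 1) * Real.Gamma (a + N + 1) * Real.Gamma (b + m + 1) /
        (N.factorial * Real.Gamma ((N : ℝ) + a + b + 1)) *
        ∑ k ∈ Finset.range (N + 1), (-1) ^ k * (N.choose k : ℝ) *
          (Real.Gamma ((N : ℝ) + a + b + 1 + k) / Real.Gamma (a + b + m + 2 + k)) := by
    rw [jacobiPoly, Finset.sum_mul, map_sum, Finset.mul_sum]
    apply Finset.sum_congr rfl
    intro k hk
    have hkN : k ≤ N := Nat.lt_succ_iff.mp (Finset.mem_range.mp hk)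
    have hk0 : (0 : ℝ) ≤ k := k.cast_nonneg
    have hpow : (C (1 / 2 : ℝ) * (X - 1)) ^ k * (1 + X) ^ m
        = C ((-1 / 2) ^ k) * ((1 - X) ^ k * (1 + X) ^ m) := by
      rw [C_pow, ← mul_assoc, ← mul_pow]
      congr 2
      rw [neg_div, C_neg]
      ring
    rw [mul_assoc, hpow, jacobiFunctional_C_mul, jacobiFunctional_C_mul, jacobiFunctional_moment]
    have g1 := ascPochhammer_eval_mul_Gamma hs k
    have g2 := ascPochhammer_eval_mul_Gamma (s := a + k + 1) (by linarith) (N - k)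
    have e3 : a + k + 1 + ((N - k : ℕ) : ℝ) = a + N + 1 := by
      rw [Nat.cast_sub hkN]; ring
    rw [e3] at g2
    have e4 : a + b + k + m + 2 = a + b + m + 2 + k := by ring
    have e5 : a + b + k + m + 1 = a + b + m + 1 + k := by ring
    have hfac : (N.choose k : ℝ) = N.factorial / (k.factorial * (N - k).factorial) :=
      Nat.cast_choose ℝ hkN
    rw [← g1, ← g2, e4, e5, hfac, Real.rpow_add (by norm_num), Real.rpow_natCast, div_pow]
    have hG := (Real.Gamma_pos_of_pos (show 0 < a + b + m + 2 + k by linarith)).ne'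
    field_simp
  rw [step, key]
  field_simp

theorem natDegree_jacobiPoly_le (N : ℕ) (a b : ℝ) : (jacobiPoly N a b).natDegree ≤ N := by
  rw [jacobiPoly]
  apply natDegree_sum_le_of_forall_le
  intro k hk
  have hkN : k ≤ N := Nat.lt_succ_iff.mp (Finset.mem_range.mp hk)
  refine (natDegree_C_mul_le _ _).trans (natDegree_pow_le.trans ?_)
  have : (C (1 / 2 : ℝ) * (X - 1)).natDegree ≤ 1 := by compute_degree
  nlinarith

theorem coeff_jacobiPoly_self (N : ℕ) (a b : ℝ) :
    (jacobiPoly N a b).coeff N =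
      (ascPochhammer ℝ N).eval ((N : ℝ) + a + b + 1) / (N.factorial * 2 ^ N) := by
  have hdeg : (C (1 / 2 : ℝ) * (X - 1)).natDegree ≤ 1 := by compute_degree
  rw [jacobiPoly, finsetSum_coeff, Finset.sum_range_succ, Finset.sum_eq_zero, zero_add,
    coeff_C_mul]
  · have : ((C (1 / 2 : ℝ) * (X - 1)) ^ N).coeff N = (1 / 2) ^ N := by
      have h := coeff_pow_of_natDegree_le hdeg (m := N)
      rw [mul_one] at h
      rw [h, coeff_C_mul]
      simp [coeff_one]
    rw [this]
    simp
    field_simp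
  · intro k hk
    apply coeff_eq_zero_of_natDegree_lt
    refine (natDegree_C_mul_le _ _).trans_lt (natDegree_pow_le.trans_lt ?_)
    have := Finset.mem_range.mp hk
    nlinarith

theorem coeff_jacobiPoly_self_pos {N : ℕ} {a b : ℝ} (hs : 0 < (N : ℝ) + a + b + 1) :
    0 < (jacobiPoly N a b).coeff N := by
  rw [coeff_jacobiPoly_self]
  have := ascPochhammer_pos N _ hs
  positivity

/-- A polynomial of degree at most `N` pairs with the Jacobi polynomial of degree `N` through its
coefficient of index `N`. -/
theorem jacobiFunctional_jacobiPoly_mul_of_natDegree_le {a b : ℝ} (ha : -1 < a) (hb : -1 < b)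
    {N : ℕ} (hs : 0 < (N : ℝ) + a + b + 1) {q : ℝ[X]} (hq : q.natDegree ≤ N) :
    jacobiFunctional ha hb (jacobiPoly N a b * q) =
      q.coeff N * (2 ^ (a + b + N + 1) * Real.Gamma (a + N + 1) * Real.Gamma (b + N + 1) /
        Real.Gamma (a + b + N + N + 2)) := by
  -- Expanding in powers of `1 + X` makes the previous formula applicable, and the translation keeps
  -- the coefficient of index `N`.
  set r := taylor (-1) q with hr
  have hrdeg : r.natDegree = q.natDegree := natDegree_taylor q (-1)
  have hrc : r.coeff N = q.coeff N := by
    rcases hq.lt_or_eq with h | h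
    · rw [coeff_eq_zero_of_natDegree_lt h, coeff_eq_zero_of_natDegree_lt (hrdeg ▸ h)]
    · have := leadingCoeff_taylor (-1) (f := q)
      rw [leadingCoeff, leadingCoeff, ← hr, hrdeg, h] at this
      exact this
  have hsum : q = ∑ m ∈ Finset.range (N + 1), C (r.coeff m) * (1 + X) ^ m := by
    conv_lhs => rw [← sum_taylor_eq q (-1), sum_over_range' _ (by simp) (N + 1)
      (Nat.lt_succ_of_le (hrdeg.trans_le hq))]
    simp [add_comm, hr]
  conv_lhs => rw [hsum]
  rw [Finset.mul_sum, map_sum]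
  simp only [mul_left_comm (jacobiPoly N a b) (C _), jacobiFunctional_C_mul,
    jacobiFunctional_jacobiPoly_mul ha hb hs]
  rw [Finset.sum_range_succ, Finset.sum_eq_zero, zero_add, hrc]
  · have : (ascPochhammer ℝ N).eval ((N : ℝ) + 1 - N) = N.factorial := by
      rw [add_sub_cancel_left, ascPochhammer_eval_one]
    rw [this]
    field_simp
  · intro m hm
    rw [ascPochhammer_eval_neg_of_lt (Finset.mem_range.mp hm), mul_zero, mul_zero]

end

/-! ### Coefficients and the monic Jacobi polynomial -/

noncomputable section

theorem coeff_X_mul_derivative (f : ℝ[X]) (m : ℕ) :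
    (X * derivative f).coeff m = m * f.coeff m := by
  cases m with
  | zero => simp
  | succ m => rw [coeff_X_mul, coeff_derivative]; push_cast; ring

theorem coeff_succ_one_sub_X_sq_mul_derivative (f : ℝ[X]) (m : ℕ) :
    ((1 - X ^ 2) * derivative f).coeff (m + 1) =
      (m + 2) * f.coeff (m + 2) - m * f.coeff m := by
  have : (1 - X ^ 2) * derivative f = derivative f - X * (X * derivative f) := by ring
  rw [this, coeff_sub, coeff_X_mul, coeff_X_mul_derivative, coeff_derivative]
  push_cast
  ring

theorem coeff_succ_one_sub_X_mul (f : ℝ[X]) (m : ℕ) :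
    ((1 - X) * f).coeff (m + 1) = f.coeff (m + 1) - f.coeff m := by
  rw [sub_mul, one_mul, coeff_sub, coeff_X_mul]

theorem coeff_succ_one_add_X_mul (f : ℝ[X]) (m : ℕ) :
    ((1 + X) * f).coeff (m + 1) = f.coeff (m + 1) + f.coeff m := by
  rw [add_mul, one_mul, coeff_add, coeff_X_mul]

/-- Both sides have the same coefficient of index `N`, so their difference has degree below `N` and
vanishes at `N` distinct points. -/
theorem jacobiPoly_eq_C_mul_nodal {N : ℕ} {a b : ℝ} {x : Fin N → ℝ} (hx : Function.Injective x)
    (hroot : ∀ j, (jacobiPoly N a b).IsRoot (x j)) :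
    jacobiPoly N a b = C ((jacobiPoly N a b).coeff N) * Lagrange.nodal Finset.univ x := by
  have hdeg : (Lagrange.nodal Finset.univ x).natDegree = N := by
    simp [Lagrange.natDegree_nodal]
  have hmonic : (Lagrange.nodal Finset.univ x).Monic := Lagrange.nodal_monic
  apply eq_of_degree_sub_lt_of_eval_index_eq Finset.univ hx.injOn
  · rw [Finset.card_univ, Fintype.card_fin, degree_lt_iff_coeff_zero]
    intro m hm
    rw [coeff_sub, coeff_C_mul]
    rcases hm.eq_or_lt with rfl | h
    · have := hmonic.coeff_natDegree
      rw [hdeg] at this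
      rw [this]
      ring
    · rw [coeff_eq_zero_of_natDegree_lt ((natDegree_jacobiPoly_le N a b).trans_lt h),
        coeff_eq_zero_of_natDegree_lt (p := Lagrange.nodal _ _) (hdeg.trans_lt h)]
      ring
  · intro j _
    rw [hroot j, eval_mul, Lagrange.eval_nodal_at_node (Finset.mem_univ j), mul_zero]

/-- The squared norm of the monic Jacobi polynomial of degree `N`. -/
def monicJacobiNormSq (N : ℕ) (a b : ℝ) : ℝ :=
  2 ^ (a + b + N + 1) * Real.Gamma (a + N + 1) * Real.Gamma (b + N + 1) /
    Real.Gamma (a + b + N + N + 2) / (jacobiPoly N a b).coeff N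

theorem monicJacobiNormSq_pos {N : ℕ} {a b : ℝ} (ha : -1 < a) (hb : -1 < b)
    (hs : 0 < (N : ℝ) + a + b + 1) : 0 < monicJacobiNormSq N a b := by
  have hN : (0 : ℝ) ≤ N := N.cast_nonneg
  have h1 := Real.Gamma_pos_of_pos (show 0 < a + N + 1 by linarith)
  have h2 := Real.Gamma_pos_of_pos (show 0 < b + N + 1 by linarith)
  have h3 := Real.Gamma_pos_of_pos (show 0 < a + b + N + N + 2 by linarith)
  have h4 := coeff_jacobiPoly_self_pos hs
  rw [monicJacobiNormSq]
  positivity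

/-- This reduces the later integrals to reading off a single coefficient. -/
theorem jacobiFunctional_nodal_mul {a b : ℝ} (ha : -1 < a) (hb : -1 < b) {N : ℕ}
    (hs : 0 < (N : ℝ) + a + b + 1) {x : Fin N → ℝ} (hx : Function.Injective x)
    (hroot : ∀ j, (jacobiPoly N a b).IsRoot (x j)) {q : ℝ[X]} (hq : q.natDegree ≤ N) :
    jacobiFunctional ha hb (Lagrange.nodal Finset.univ x * q) =
      q.coeff N * monicJacobiNormSq N a b := by
  have h := jacobiFunctional_jacobiPoly_mul_of_natDegree_le ha hb hs hq
  have hk := (coeff_jacobiPoly_self_pos hs).ne'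
  rw [jacobiPoly_eq_C_mul_nodal hx hroot, mul_assoc, jacobiFunctional_C_mul] at h
  rw [monicJacobiNormSq, ← mul_div_assoc, ← h]
  field_simp

/-! ### The Gauss-Jacobi rule -/

section GaussRule

variable {a b : ℝ} (ha : -1 < a) (hb : -1 < b) {n : ℕ} {x : Fin (n + 1) → ℝ}

/-- The Gauss-Jacobi weights. -/
def gaussJacobiWeight (x : Fin (n + 1) → ℝ) (j : Fin (n + 1)) : ℝ :=
  jacobiFunctional ha hb (Lagrange.basis Finset.univ x j)

/-- Exactness of the Gauss-Jacobi rule. -/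
theorem jacobiFunctional_eq_sum_gaussJacobiWeight
    (hs : 0 < ((n + 1 : ℕ) : ℝ) + a + b + 1) (hx : Function.Injective x)
    (hroot : ∀ j, (jacobiPoly (n + 1) a b).IsRoot (x j)) {f : ℝ[X]}
    (hf : f.natDegree ≤ 2 * n + 1) :
    jacobiFunctional ha hb f = ∑ j, gaussJacobiWeight ha hb x j * f.eval (x j) := by
  set p := Lagrange.nodal Finset.univ x with hp
  have hmonic : p.Monic := Lagrange.nodal_monic
  have hdeg : p.natDegree = n + 1 := by simp [hp, Lagrange.natDegree_nodal]
  have hdeg' : p.degree = (Finset.univ : Finset (Fin (n + 1))).card := Lagrange.degree_nodal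
  -- The quotient has degree at most `n`, so orthogonality kills its product with `p`; the remainder
  -- is the interpolant of `f` at the nodes.
  have hqdeg : (f /ₘ p).natDegree < n + 1 := by
    rw [natDegree_divByMonic f hmonic, hdeg]
    omega
  have hrem : f %ₘ p = Lagrange.interpolate Finset.univ x fun j => f.eval (x j) := by
    apply Lagrange.eq_interpolate_of_eval_eq _ hx.injOn
    · rw [← hdeg']
      exact degree_modByMonic_lt f hmonic
    · intro j hj
      have := congrArg (eval (x j)) (modByMonic_add_div f p)
      rw [eval_add, eval_mul, hp, Lagrange.eval_nodal_at_node hj, zero_mul, add_zero] at this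
      exact this
  conv_lhs => rw [← modByMonic_add_div f p]
  rw [map_add, jacobiFunctional_nodal_mul ha hb hs hx hroot hqdeg.le,
    coeff_eq_zero_of_natDegree_lt hqdeg, zero_mul, add_zero, hrem, Lagrange.interpolate_apply,
    map_sum]
  apply Finset.sum_congr rfl
  intro j _
  rw [jacobiFunctional_C_mul, gaussJacobiWeight, mul_comm]

/-- The rule is exact on the square of a Lagrange basis polynomial, of degree `2n`, and there the
sum reduces to the weight itself. -/
theorem gaussJacobiWeight_nonneg (hs : 0 < ((n + 1 : ℕ) : ℝ) + a + b + 1)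
    (hx : Function.Injective x) (hroot : ∀ j, (jacobiPoly (n + 1) a b).IsRoot (x j))
    (j : Fin (n + 1)) : 0 ≤ gaussJacobiWeight ha hb x j := by
  have hdeg : (Lagrange.basis Finset.univ x j).natDegree = n := by
    rw [Lagrange.natDegree_basis hx.injOn (Finset.mem_univ j)]
    simp
  have h := jacobiFunctional_eq_sum_gaussJacobiWeight ha hb hs hx hroot
    (f := Lagrange.basis Finset.univ x j * Lagrange.basis Finset.univ x j)
    (natDegree_mul_le.trans (by omega))
  rw [Finset.sum_eq_single j] at h
  · rw [eval_mul, Lagrange.eval_basis_self hx.injOn (Finset.mem_univ j), mul_one, mul_one] at h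
    rw [← h]
    apply jacobiFunctional_nonneg
    intro t
    rw [eval_mul]
    exact mul_self_nonneg _
  · intro i _ hij
    rw [eval_mul, Lagrange.eval_basis_of_ne hij.symm (Finset.mem_univ i), mul_zero, mul_zero]
  · simp

/-- The classical formula for the Gauss-Jacobi weights. -/
theorem gaussJacobiWeight_mul (hs : 0 < ((n + 1 : ℕ) : ℝ) + a + b + 1)
    (hx : Function.Injective x) (hroot : ∀ j, (jacobiPoly (n + 1) a b).IsRoot (x j))
    (j : Fin (n + 1)) :
    gaussJacobiWeight ha hb x j *
        ((1 - x j ^ 2) * (derivative (Lagrange.nodal Finset.univ x)).eval (x j) ^ 2) =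
      (2 * ((n + 1 : ℕ) : ℝ) + a + b + 1) * monicJacobiNormSq (n + 1) a b := by
  set p := Lagrange.nodal Finset.univ x with hp
  set e := Lagrange.nodal (Finset.univ.erase j) x with he
  have hpmonic : p.Monic := Lagrange.nodal_monic
  have hpdeg : p.natDegree = n + 1 := by simp [hp, Lagrange.natDegree_nodal]
  have hemonic : e.Monic := Lagrange.nodal_monic
  have hedeg : e.natDegree = n := by simp [he, Lagrange.natDegree_nodal]
  have hetop : e.coeff n = 1 := hedeg ▸ hemonic.coeff_natDegree
  have hehigh : ∀ m, n < m → e.coeff m = 0 := fun m hm =>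
    coeff_eq_zero_of_natDegree_lt (hedeg.trans_lt hm)
  have hphigh : ∀ m, n + 1 < m → p.coeff m = 0 := fun m hm =>
    coeff_eq_zero_of_natDegree_lt (hpdeg.trans_lt hm)
  have hD : (derivative p).eval (x j) = e.eval (x j) :=
    Lagrange.eval_nodal_derivative_eval_node_eq (Finset.mem_univ j)
  -- The multiple of `X p` cancels the term of degree `n + 2` without changing values at the nodes.
  -- Thus `R * e` has degree at most `2n + 1`, and its Gauss sum has only the term at `x j`.
  set R := (1 - X ^ 2) * derivative p + C ((n + 1 : ℕ) : ℝ) * (X * p) with hR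
  have hRdeg : R.natDegree ≤ n + 1 := by
    rw [natDegree_le_iff_coeff_eq_zero]
    rintro (_ | m) hm
    · omega
    rw [hR, coeff_add, coeff_succ_one_sub_X_sq_mul_derivative, coeff_C_mul, coeff_X_mul,
      hphigh (m + 2) (by omega)]
    rcases (show n + 1 ≤ m by omega).eq_or_lt with rfl | h
    · ring
    · rw [hphigh m h]
      ring
  have hgauss := jacobiFunctional_eq_sum_gaussJacobiWeight ha hb hs hx hroot (f := R * e)
    (natDegree_mul_le.trans (by omega))
  rw [Finset.sum_eq_single j] at hgauss
  rotate_left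
  · intro i _ hij
    rw [eval_mul, he, Lagrange.eval_nodal_at_node (Finset.mem_erase.mpr ⟨hij, Finset.mem_univ i⟩),
      mul_zero, mul_zero]
  · simp
  have hRe : R.eval (x j) = (1 - x j ^ 2) * (derivative p).eval (x j) := by
    have : p.eval (x j) = 0 := Lagrange.eval_nodal_at_node (Finset.mem_univ j)
    simp [hR, this]
  -- Integration by parts replaces `(1 - X²) p' e` by `-p B`, and only the coefficient `-(n+a+b+2)`
  -- of `B` at index `n + 1` counts. The term `(n+1) p X e` contributes the remaining `n + 1`.
  set B := (1 - X ^ 2) * derivative e + C (b + 1) * ((1 - X) * e) - C (a + 1) * ((1 + X) * e)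
    with hB
  have hBcoeff : ∀ m, B.coeff (m + 1) = (m + 2) * e.coeff (m + 2) - m * e.coeff m +
      (b + 1) * (e.coeff (m + 1) - e.coeff m) - (a + 1) * (e.coeff (m + 1) + e.coeff m) := by
    intro m
    rw [hB, coeff_sub, coeff_add, coeff_succ_one_sub_X_sq_mul_derivative, coeff_C_mul, coeff_C_mul,
      coeff_succ_one_sub_X_mul, coeff_succ_one_add_X_mul]
  have hBdeg : B.natDegree ≤ n + 1 := by
    rw [natDegree_le_iff_coeff_eq_zero]
    rintro (_ | m) hm
    · omega
    rw [hBcoeff, hehigh m (by omega), hehigh (m + 1) (by omega), hehigh (m + 2) (by omega)]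
    ring
  have hXedeg : (X * e).natDegree ≤ n + 1 := by
    rw [natDegree_X_mul hemonic.ne_zero, hedeg]
  have hparts := jacobiFunctional_integrate_by_parts ha hb (p * e)
  have hsplit : (1 - X ^ 2) * derivative (p * e) + C (b + 1) * ((1 - X) * (p * e))
      - C (a + 1) * ((1 + X) * (p * e)) = (1 - X ^ 2) * derivative p * e + p * B := by
    rw [derivative_mul, hB]
    ring
  have hRe' : R * e = (1 - X ^ 2) * derivative p * e + C ((n + 1 : ℕ) : ℝ) * (p * (X * e)) := by
    rw [hR]
    ring
  rw [hsplit, map_add, jacobiFunctional_nodal_mul ha hb hs hx hroot hBdeg, hBcoeff,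
    hehigh (n + 2) (by omega), hehigh (n + 1) (by omega), hetop] at hparts
  rw [hRe', map_add, jacobiFunctional_C_mul, jacobiFunctional_nodal_mul ha hb hs hx hroot hXedeg,
    coeff_X_mul, hetop, ← hRe', eval_mul, hRe, ← hD] at hgauss
  push_cast at hgauss ⊢
  linear_combination hparts - hgauss

/-- The zeros of a Jacobi polynomial, when they are all real and simple, lie in `(-1, 1)`. -/
theorem jacobiPoly_root_sq_lt_one (hs : 0 < ((n + 1 : ℕ) : ℝ) + a + b + 1)
    (ha : -1 < a) (hb : -1 < b)
    (hx : Function.Injective x) (hroot : ∀ j, (jacobiPoly (n + 1) a b).IsRoot (x j))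
    (j : Fin (n + 1)) : x j ^ 2 < 1 := by
  have h := gaussJacobiWeight_mul ha hb hs hx hroot j
  have hw := gaussJacobiWeight_nonneg ha hb hs hx hroot j
  have hn : (0 : ℝ) ≤ ((n + 1 : ℕ) : ℝ) := Nat.cast_nonneg _
  have hK : 0 < (2 * ((n + 1 : ℕ) : ℝ) + a + b + 1) * monicJacobiNormSq (n + 1) a b :=
    mul_pos (by linarith) (monicJacobiNormSq_pos ha hb hs)
  rw [← h] at hK
  -- A nonnegative weight times `(1 - x_j²) p'(x_j)²` is positive, which forces `1 - x_j² > 0`.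
  have h1 := pos_of_mul_pos_right hK hw
  have h2 := pos_of_mul_pos_left h1 (sq_nonneg _)
  linarith

end GaussRule

/-! ### The norm for the exponents `(a, b)` and the normalizing constant -/

/-- The squared norms of the monic Jacobi polynomial for the weights with exponents `(a, b)` and
`(a, b + 1)`. -/
theorem jacobiFunctional_nodal_sq {a b : ℝ} (ha : -1 < a) (hb : -1 < b) {n : ℕ}
    {x : Fin (n + 1) → ℝ} (hx : Function.Injective x)
    (hroot : ∀ j, (jacobiPoly (n + 1) a (b + 1)).IsRoot (x j)) :
    2 * (b + 1) * jacobiFunctional ha hb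
        (Lagrange.nodal Finset.univ x * Lagrange.nodal Finset.univ x) =
      (2 * ((n + 1 : ℕ) : ℝ) + a + (b + 1) + 1) * monicJacobiNormSq (n + 1) a (b + 1) := by
  have hb' : -1 < b + 1 := by linarith
  have hs : 0 < ((n + 1 : ℕ) : ℝ) + a + (b + 1) + 1 := by
    have : (0 : ℝ) ≤ ((n + 1 : ℕ) : ℝ) := Nat.cast_nonneg _
    linarith
  set p := Lagrange.nodal Finset.univ x with hp
  have hpmonic : p.Monic := Lagrange.nodal_monic
  have hpdeg : p.natDegree = n + 1 := by simp [hp, Lagrange.natDegree_nodal]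
  have hptop : p.coeff (n + 1) = 1 := hpdeg ▸ hpmonic.coeff_natDegree
  have hphigh : ∀ m, n + 1 < m → p.coeff m = 0 := fun m hm =>
    coeff_eq_zero_of_natDegree_lt (hpdeg.trans_lt hm)
  have hcoeff : ∀ m, ((1 - X) * derivative p).coeff (m + 1) =
      (m + 2) * p.coeff (m + 2) - (m + 1) * p.coeff (m + 1) := by
    intro m
    rw [coeff_succ_one_sub_X_mul, coeff_derivative, coeff_derivative]
    push_cast
    ring
  have hdeg : ((1 - X) * derivative p).natDegree ≤ n + 1 := by
    rw [natDegree_le_iff_coeff_eq_zero]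
    rintro (_ | m) hm
    · omega
    rw [hcoeff, hphigh (m + 1) (by omega), hphigh (m + 2) (by omega)]
    ring
  have hparts := jacobiFunctional_integrate_by_parts ha hb (p * p)
  -- Writing `1 - X = 2 - (1 + X)` isolates `2(b+1) p²`; everything else carries a factor `1 + X`,
  -- hence passes to the exponents `(a, b + 1)`, for which `p` is orthogonal to lower degrees.
  have hsplit : (1 - X ^ 2) * derivative (p * p) + C (b + 1) * ((1 - X) * (p * p))
      - C (a + 1) * ((1 + X) * (p * p)) =
      C (2 * (b + 1)) * (p * p) + (1 + X) * (C 2 * (p * ((1 - X) * derivative p))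
        - C (a + (b + 1) + 1) * (p * p)) := by
    rw [derivative_mul]
    simp only [C_add, C_mul, C_1, C_ofNat]
    ring
  rw [hsplit, map_add, jacobiFunctional_C_mul, jacobiFunctional_one_add_X_mul ha hb hb', map_sub,
    jacobiFunctional_C_mul, jacobiFunctional_C_mul,
    jacobiFunctional_nodal_mul ha hb' hs hx hroot hdeg,
    jacobiFunctional_nodal_mul ha hb' hs hx hroot hpdeg.le, hcoeff, hphigh (n + 2) (by omega),
    hptop] at hparts
  push_cast
  linear_combination hparts

/-- The absolute value of `jacobiBaryConst`. -/
def jacobiBaryConstAbs (n : ℕ) (a b : ℝ) : ℝ :=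
  Real.Gamma (2 * n + a + b + 3) / (2 : ℝ) ^ ((n : ℝ) + 1 + (a + b + 1) / 2) *
    (1 / √(((n + 1).factorial : ℝ) * Real.Gamma (n + a + b + 2) * Real.Gamma (n + a + 2) *
      Real.Gamma (n + b + 2)))

theorem jacobiBaryConst_eq (n : ℕ) (a b : ℝ) :
    jacobiBaryConst n a b = (-1) ^ n * jacobiBaryConstAbs n a b := by
  rw [jacobiBaryConst, jacobiBaryConstAbs, mul_assoc]

theorem jacobiBaryConstAbs_pos {n : ℕ} {a b : ℝ} (ha : -1 < a) (hb : -1 < b) :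
    0 < jacobiBaryConstAbs n a b := by
  have hn : (0 : ℝ) ≤ n := n.cast_nonneg
  have h1 := Real.Gamma_pos_of_pos (show 0 < 2 * n + a + b + 3 by linarith)
  have h2 := Real.Gamma_pos_of_pos (show 0 < n + a + b + 2 by linarith)
  have h3 := Real.Gamma_pos_of_pos (show 0 < n + a + 2 by linarith)
  have h4 := Real.Gamma_pos_of_pos (show 0 < n + b + 2 by linarith)
  rw [jacobiBaryConstAbs]
  positivity

theorem jacobiBaryConstAbs_sq_mul {n : ℕ} {a b : ℝ} (ha : -1 < a) (hb : -1 < b) :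
    jacobiBaryConstAbs n a b ^ 2 *
      ((2 * ((n + 1 : ℕ) : ℝ) + a + b + 1) * monicJacobiNormSq (n + 1) a b) = 1 := by
  have hn : (0 : ℝ) ≤ n := n.cast_nonneg
  have h1 := Real.Gamma_pos_of_pos (show 0 < 2 * n + a + b + 3 by linarith)
  have h2 := Real.Gamma_pos_of_pos (show 0 < n + a + b + 2 by linarith)
  have h3 := Real.Gamma_pos_of_pos (show 0 < n + a + 2 by linarith)
  have h4 := Real.Gamma_pos_of_pos (show 0 < n + b + 2 by linarith)
  have hs : 0 < (n : ℝ) + a + b + 2 := by linarith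
  have hne : 2 * (n : ℝ) + a + b + 3 ≠ 0 := by linarith
  -- The leading coefficient as a quotient of Gamma values; `Real.Gamma_add_one` will cancel the
  -- factor `2(n+1)+a+b+1`.
  have hpoch := ascPochhammer_eval_mul_Gamma hs (n + 1)
  have hpoch_pos := ascPochhammer_pos (n + 1) _ hs
  have e0 : (n : ℝ) + a + b + 2 + (n + 1 : ℕ) = 2 * n + a + b + 3 := by push_cast; ring
  have e1 : ((n + 1 : ℕ) : ℝ) + a + b + 1 = n + a + b + 2 := by push_cast; ring
  have e2 : a + ((n + 1 : ℕ) : ℝ) + 1 = n + a + 2 := by push_cast; ring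
  have e3 : b + ((n + 1 : ℕ) : ℝ) + 1 = n + b + 2 := by push_cast; ring
  have e4 : a + b + ((n + 1 : ℕ) : ℝ) + ((n + 1 : ℕ) : ℝ) + 2 = 2 * n + a + b + 3 + 1 := by
    push_cast; ring
  have e5 : 2 * ((n + 1 : ℕ) : ℝ) + a + b + 1 = 2 * n + a + b + 3 := by push_cast; ring
  -- One power of two comes from the moment, the other from the leading coefficient; this explains
  -- the exponent in `jacobiBaryConst`.
  have hpow : (2 : ℝ) ^ (a + b + ((n + 1 : ℕ) : ℝ) + 1) * 2 ^ (n + 1) =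
      ((2 : ℝ) ^ ((n : ℝ) + 1 + (a + b + 1) / 2)) ^ 2 := by
    rw [← Real.rpow_natCast 2 (n + 1), ← Real.rpow_add (by norm_num), ← Real.rpow_mul_natCast
      (by norm_num)]
    congr 1
    push_cast
    ring
  rw [e0] at hpoch
  rw [monicJacobiNormSq, coeff_jacobiPoly_self, jacobiBaryConstAbs, e1, e2, e3, e4, e5,
    Real.Gamma_add_one hne, ← hpoch, mul_pow, div_pow, div_pow, Real.sq_sqrt (by positivity),
    ← hpow]
  set g := 2 * (n : ℝ) + a + b + 3
  field_simp

/-- Recovers a number from its sign and its square. -/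
theorem eq_sign_mul_sqrt {ε c K l y : ℝ} (hε : ε * ε = 1) (hl : 0 < ε * l) (hc : 0 < c)
    (hK : c ^ 2 * K = 1) (hy : y = K * l ^ 2) : l = ε * c * √y := by
  have : y = (ε * l / c) ^ 2 := by
    rw [hy]
    field_simp
    linear_combination l ^ 2 * hK - l ^ 2 * hε
  rw [this, Real.sqrt_sq (by positivity)]
  field_simp
  linear_combination -l * hε

/-! ### Signs, and the barycentric weights in terms of the nodal polynomial -/

theorem neg_one_pow_mul_self (m : ℕ) : (-1 : ℝ) ^ m * (-1) ^ m = 1 := by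
  rw [← mul_pow]
  norm_num

/-- In `p'(x_j) = ∏_{i ≠ j} (x_j - x_i)` the negative factors are those with `i > j`; there are `n -
j` of them, and `n - j` has the parity of `n + j`. -/
theorem neg_one_pow_mul_eval_derivative_nodal_pos {n : ℕ} {x : Fin (n + 1) → ℝ} (hx : StrictMono x)
    (j : Fin (n + 1)) :
    0 < (-1) ^ (n + j : ℕ) * (derivative (Lagrange.nodal Finset.univ x)).eval (x j) := by
  rw [Lagrange.eval_nodal_derivative_eval_node_eq (Finset.mem_univ j), Lagrange.eval_nodal]
  have hsign : (-1 : ℝ) ^ (n + j : ℕ) =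
      ∏ i ∈ Finset.univ.erase j, (if j < i then (-1 : ℝ) else 1) := by
    have hfilter : (Finset.univ.erase j).filter (fun i => j < i) = Finset.Ioi j := by
      ext i
      simp only [Finset.mem_filter, Finset.mem_erase, Finset.mem_univ, Finset.mem_Ioi, and_true,
        and_iff_right_iff_imp]
      exact fun h => h.ne'
    rw [Finset.prod_ite, Finset.prod_const, Finset.prod_const_one, mul_one, hfilter, Fin.card_Ioi]
    have : n + (j : ℕ) = (n + 1 - 1 - j) + 2 * j := by omega
    rw [this, pow_add, pow_mul]
    norm_num
  rw [hsign, ← Finset.prod_mul_distrib]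
  apply Finset.prod_pos
  intro i hi
  rcases lt_or_gt_of_ne (Finset.ne_of_mem_erase hi) with h | h
  · rw [if_neg h.not_gt, one_mul, sub_pos]
    exact hx h
  · rw [if_pos h]
    linarith [hx h]

theorem neg_one_pow_mul_eval_neg_one_nodal_pos {n : ℕ} {x : Fin (n + 1) → ℝ}
    (hx : ∀ j, -1 < x j) :
    0 < (-1) ^ (n + 1) * (Lagrange.nodal Finset.univ x).eval (-1) := by
  have : (-1 : ℝ) ^ (n + 1) = ∏ _i : Fin (n + 1), (-1 : ℝ) := by simp
  rw [Lagrange.eval_nodal, this, ← Finset.prod_mul_distrib]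
  apply Finset.prod_pos
  intro i _
  linarith [hx i]

theorem nodal_radauNodes {n : ℕ} (x : Fin (n + 1) → ℝ) :
    Lagrange.nodal Finset.univ (radauNodes x) = (1 + X) * Lagrange.nodal Finset.univ x := by
  rw [Lagrange.nodal_eq, Lagrange.nodal_eq, Fin.prod_univ_succ]
  simp [radauNodes, add_comm]

theorem baryWeight_radauNodes_zero {n : ℕ} (x : Fin (n + 1) → ℝ) :
    baryWeight (radauNodes x) 0 = ((Lagrange.nodal Finset.univ x).eval (-1))⁻¹ := by
  rw [baryWeight, Lagrange.nodalWeight_eq_eval_derivative_nodal (Finset.mem_univ _),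
    nodal_radauNodes, derivative_mul]
  simp [radauNodes]

theorem baryWeight_radauNodes_succ {n : ℕ} (x : Fin (n + 1) → ℝ) (j : Fin (n + 1)) :
    baryWeight (radauNodes x) j.succ =
      ((1 + x j) * (derivative (Lagrange.nodal Finset.univ x)).eval (x j))⁻¹ := by
  rw [baryWeight, Lagrange.nodalWeight_eq_eval_derivative_nodal (Finset.mem_univ _),
    nodal_radauNodes, derivative_mul]
  have : (Lagrange.nodal Finset.univ x).eval (x j) = 0 :=
    Lagrange.eval_nodal_at_node (Finset.mem_univ j)
  simp [radauNodes, this]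

/-! ### The Gauss-Jacobi-Radau rule -/

section RadauRule

variable {α β : ℝ} (hα : -1 < α) (hβ : -1 < β) {n : ℕ} {x : Fin (n + 1) → ℝ}

theorem isGaussJacobiRadauWeights_iff {w : Fin (n + 2) → ℝ} :
    IsGaussJacobiRadauWeights α β x w ↔ ∀ f : ℝ[X], f.natDegree ≤ 2 * n + 2 →
      jacobiFunctional hα hβ f = w 0 * f.eval (-1) + ∑ j, w j.succ * f.eval (x j) := by
  simp only [IsGaussJacobiRadauWeights, Fin.sum_univ_succ (n := n + 1), radauNodes, Fin.cons_zero,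
    Fin.cons_succ, jacobiFunctional_apply]

/-- Test on `1 + X` times a Lagrange basis polynomial: the factor removes the endpoint and raises
`β` by one. -/
theorem IsGaussJacobiRadauWeights.succ_mul (hα : -1 < α) (hβ : -1 < β) (hβ' : -1 < β + 1) (hx : Function.Injective x)
    {w : Fin (n + 2) → ℝ} (hw : IsGaussJacobiRadauWeights α β x w) (j : Fin (n + 1)) :
    w j.succ * (1 + x j) = gaussJacobiWeight hα hβ' x j := by
  have hdeg : (Lagrange.basis Finset.univ x j).natDegree = n := by
    rw [Lagrange.natDegree_basis hx.injOn (Finset.mem_univ j)]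
    simp
  have hdeg1 : (1 + X : ℝ[X]).natDegree ≤ 1 := by compute_degree
  have h := (isGaussJacobiRadauWeights_iff hα hβ).mp hw
    ((1 + X) * Lagrange.basis Finset.univ x j) (natDegree_mul_le.trans (by omega))
  rw [jacobiFunctional_one_add_X_mul hα hβ hβ', Finset.sum_eq_single j] at h
  · simp only [eval_mul, eval_add, eval_one, eval_X,
      Lagrange.eval_basis_self hx.injOn (Finset.mem_univ j)] at h
    rw [gaussJacobiWeight, h]
    ring
  · intro i _ hij
    rw [eval_mul, Lagrange.eval_basis_of_ne hij.symm (Finset.mem_univ i), mul_zero, mul_zero]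
  · simp

/-- The square of the nodal polynomial has degree `2n + 2`, the largest one allowed, and only the
endpoint term survives. -/
theorem IsGaussJacobiRadauWeights.zero_mul_sq {w : Fin (n + 2) → ℝ}
    (hw : IsGaussJacobiRadauWeights α β x w) :
    w 0 * (Lagrange.nodal Finset.univ x).eval (-1) ^ 2 =
      jacobiFunctional hα hβ (Lagrange.nodal Finset.univ x * Lagrange.nodal Finset.univ x) := by
  have hdeg : (Lagrange.nodal Finset.univ x).natDegree = n + 1 := by
    simp [Lagrange.natDegree_nodal]
  rw [(isGaussJacobiRadauWeights_iff hα hβ).mp hw _ (natDegree_mul_le.trans (by omega)),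
    Finset.sum_eq_zero, add_zero, eval_mul, sq]
  intro j hj
  rw [eval_mul, Lagrange.eval_nodal_at_node hj, mul_zero, mul_zero]

/-- The interior weights are forced to be Gauss weights divided by `1 + x_j`, and `f = 1` forces the
endpoint weight. Conversely these weights work because the Gauss rule is exact on `g` in `f = (1+X)
g + f(-1)`. -/
theorem existsUnique_isGaussJacobiRadauWeights (hα : -1 < α) (hβ : -1 < β)
    (hx : Function.Injective x) (hroot : ∀ j, (jacobiPoly (n + 1) α (β + 1)).IsRoot (x j))
    (hx1 : ∀ j, -1 < x j) :
    ∃! w : Fin (n + 2) → ℝ, IsGaussJacobiRadauWeights α β x w := by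
  have hβ' : -1 < β + 1 := by linarith
  have hs : 0 < ((n + 1 : ℕ) : ℝ) + α + (β + 1) + 1 := by
    have : (0 : ℝ) ≤ ((n + 1 : ℕ) : ℝ) := Nat.cast_nonneg _
    linarith
  have hne : ∀ j, 1 + x j ≠ 0 := fun j => by linarith [hx1 j]
  refine ⟨Fin.cons (jacobiFunctional hα hβ 1 - ∑ j, gaussJacobiWeight hα hβ' x j / (1 + x j))
    fun j => gaussJacobiWeight hα hβ' x j / (1 + x j), ?_, ?_⟩
  · refine (isGaussJacobiRadauWeights_iff hα hβ).mpr fun f hf => ?_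
    obtain ⟨g, hg⟩ : X - C (-1) ∣ f - C (f.eval (-1)) := dvd_iff_isRoot.mpr (by simp)
    have hfg : f = (1 + X) * g + C (f.eval (-1)) * 1 := by
      rw [eq_add_of_sub_eq hg]
      simp [add_comm]
    have hgdeg : g.natDegree ≤ 2 * n + 1 := by
      by_cases hg0 : g = 0
      · simp [hg0]
      have h := congrArg natDegree hg
      rw [natDegree_sub_C, (monic_X_sub_C (-1 : ℝ)).natDegree_mul' hg0, natDegree_X_sub_C] at h
      omega
    have hI : jacobiFunctional hα hβ f = ∑ j, gaussJacobiWeight hα hβ' x j * g.eval (x j) +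
        f.eval (-1) * jacobiFunctional hα hβ 1 := by
      conv_lhs => rw [hfg]
      rw [map_add, jacobiFunctional_C_mul, jacobiFunctional_one_add_X_mul hα hβ hβ',
        jacobiFunctional_eq_sum_gaussJacobiWeight hα hβ' hs hx hroot hgdeg]
    have hterm : ∀ j, gaussJacobiWeight hα hβ' x j / (1 + x j) * f.eval (x j) =
        gaussJacobiWeight hα hβ' x j * g.eval (x j) +
          gaussJacobiWeight hα hβ' x j / (1 + x j) * f.eval (-1) := by
      intro j
      have h := congrArg (eval (x j)) hfg
      simp only [eval_add, eval_mul, eval_one, eval_X, eval_C, mul_one] at h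
      rw [h]
      have := hne j
      field_simp
    simp only [Fin.cons_zero, Fin.cons_succ]
    rw [hI, Finset.sum_congr rfl fun j _ => hterm j, Finset.sum_add_distrib, ← Finset.sum_mul]
    ring
  · intro w hw
    have hsucc : ∀ j, w j.succ = gaussJacobiWeight hα hβ' x j / (1 + x j) := fun j =>
      eq_div_of_mul_eq (hne j) (hw.succ_mul hα hβ hβ' hx j)
    have h1 := (isGaussJacobiRadauWeights_iff hα hβ).mp hw 1 (by simp)
    simp only [eval_one, mul_one, hsucc] at h1
    funext i
    refine Fin.cases ?_ (fun j => ?_) i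
    · rw [Fin.cons_zero, h1]
      ring
    · rw [Fin.cons_succ, hsucc]

end RadauRule

end

/-! ### The barycentric weights from the quadrature weights -/

theorem theorem3p4 (α β : ℝ) (hα : -1 < α) (hβ : -1 < β) (n : ℕ) (x : Fin (n + 1) → ℝ)
    (hmono : StrictMono x) (hroot : ∀ j, (jacobiPoly (n + 1) α (β + 1)).IsRoot (x j)) :
    (∃! w : Fin (n + 2) → ℝ, IsGaussJacobiRadauWeights α β x w) ∧
    ∀ w : Fin (n + 2) → ℝ, IsGaussJacobiRadauWeights α β x w →
      (∀ j : Fin (n + 1), baryWeight (radauNodes x) j.succ =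
        jacobiBaryConst n α (β + 1) * (-1) ^ (j : ℕ) * √((1 - x j) * w j.succ)) ∧
      baryWeight (radauNodes x) 0 =
        -jacobiBaryConst n α (β + 1) * √(2 * (β + 1) * w 0) ∧
      IsSimplifiedBaryWeights (radauNodes x)
        (Fin.cons (-√(2 * (β + 1) * w 0))
          (fun j : Fin (n + 1) => (-1) ^ (j : ℕ) * √((1 - x j) * w j.succ))) := by
  have hβ' : -1 < β + 1 := by linarith
  have hs : 0 < ((n + 1 : ℕ) : ℝ) + α + (β + 1) + 1 := by
    have : (0 : ℝ) ≤ ((n + 1 : ℕ) : ℝ) := Nat.cast_nonneg _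
    linarith
  have hinj := hmono.injective
  have hx1 : ∀ j, -1 < x j := fun j =>
    (abs_lt.mp ((sq_lt_one_iff_abs_lt_one _).mp
      (jacobiPoly_root_sq_lt_one hs hα hβ' hinj hroot j))).1
  refine ⟨existsUnique_isGaussJacobiRadauWeights hα hβ hinj hroot hx1, fun w hw => ?_⟩
  have hc := jacobiBaryConstAbs_pos (n := n) hα hβ'
  have hcK := jacobiBaryConstAbs_sq_mul (n := n) hα hβ'
  have hsucc : ∀ j : Fin (n + 1), baryWeight (radauNodes x) j.succ =
      jacobiBaryConst n α (β + 1) * (-1) ^ (j : ℕ) * √((1 - x j) * w j.succ) := by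
    intro j
    have hD := neg_one_pow_mul_eval_derivative_nodal_pos hmono j
    have hxj : 0 < 1 + x j := by linarith [hx1 j]
    have hD0 := right_ne_zero_of_mul hD.ne'
    -- The sign `(-1)^(n+j)` splits into the `(-1)^n` inside `jacobiBaryConst` and the displayed
    -- `(-1)^j`.
    rw [baryWeight_radauNodes_succ, eq_sign_mul_sqrt (ε := (-1) ^ (n + j : ℕ))
      (y := (1 - x j) * w j.succ)
      (l := ((1 + x j) * (derivative (Lagrange.nodal Finset.univ x)).eval (x j))⁻¹)
      (neg_one_pow_mul_self _) _ hc hcK, jacobiBaryConst_eq, pow_add]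
    · ring
    · rw [← gaussJacobiWeight_mul hα hβ' hs hinj hroot j, ← hw.succ_mul hα hβ hβ' hinj j]
      field_simp
      ring
    · have : (-1) ^ (n + j : ℕ) *
          ((1 + x j) * (derivative (Lagrange.nodal Finset.univ x)).eval (x j))⁻¹ =
          (-1) ^ (n + j : ℕ) * (derivative (Lagrange.nodal Finset.univ x)).eval (x j) /
          ((1 + x j) * (derivative (Lagrange.nodal Finset.univ x)).eval (x j) ^ 2) := by
        field_simp
      rw [this]
      positivity
  have hzero : baryWeight (radauNodes x) 0 =
      -jacobiBaryConst n α (β + 1) * √(2 * (β + 1) * w 0) := by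
    have hp := neg_one_pow_mul_eval_neg_one_nodal_pos hx1
    have hp0 := right_ne_zero_of_mul hp.ne'
    -- All `n + 1` factors of `p(-1)` are negative; the sign exceeds that of `jacobiBaryConst` by
    -- one factor `-1`, hence the minus in the formula.
    rw [baryWeight_radauNodes_zero, eq_sign_mul_sqrt (ε := (-1) ^ (n + 1))
      (y := 2 * (β + 1) * w 0) (l := ((Lagrange.nodal Finset.univ x).eval (-1))⁻¹)
      (neg_one_pow_mul_self _) _ hc hcK, jacobiBaryConst_eq, pow_succ]
    · ring
    · rw [← jacobiFunctional_nodal_sq hα hβ hinj hroot, ← hw.zero_mul_sq hα hβ]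
      field_simp
    · have : (-1) ^ (n + 1) * ((Lagrange.nodal Finset.univ x).eval (-1))⁻¹ =
          (-1) ^ (n + 1) * (Lagrange.nodal Finset.univ x).eval (-1) /
          (Lagrange.nodal Finset.univ x).eval (-1) ^ 2 := by
        field_simp
      rw [this]
      positivity
  refine ⟨hsucc, hzero, jacobiBaryConst n α (β + 1), ?_, fun i => ?_⟩
  · rw [jacobiBaryConst_eq]
    exact mul_ne_zero (pow_ne_zero _ (by norm_num)) hc.ne'
  · refine Fin.cases ?_ (fun j => ?_) i
    · rw [hzero, Fin.cons_zero]
      ring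
    · rw [hsucc, Fin.cons_succ, mul_assoc]
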